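/- Let $(\Omega,\mathcal A,\mathbb P)$ be a complete probability space, $\mathbb U$ a separable reflexive real Banach space with separable dual $\mathbb U^*$, and $\mathbb W$ a topological space with its Borel $\sigma$-field. Let $U^{ad}\subset\mathbb U$ be non-empty, closed and convex, and let $j^C,j^\Sigma:\mathbb U\times\mathbb W\to\mathbb R$ be jointly lower semicontinuous and convex in the first variable, $j^C(\cdot,w)$ being subdifferentiable on an open set containing $U^{ad}$ for every $w$. Assume that there are $c_1,c_2,d_1,d_2>0$ such that for all $u\in U^{ad}$ and $w\in\mathbb W$, every $r\in\partial_u j^C(u,w)$ satisfies $\|r\|\le c_1\|u\|+c_2$ and every $s\in\partial_u j^\Sigma(u,w)$ satisfies $\|s\|\le d_1\|u\|+d_2$. Let $W:\Omega\to\mathbb W$ be a random variable such that $j^C(u,W)$ and $j^\Sigma(u,W)$ are integrable for every $u\in U^{ad}$, put $J(u)=\mathbb E[j^C(u,W)]+\mathbb E[j^\Sigma(u,W)]$, and assume that $J(u)\to+\infty$ as $\|u\|\to\infty$, $u\in U^{ad}$. Let $W_1,W_2,\dots$ be independent random variables with the law of $W$, and $\mathcal F_k=\sigma(W_1,\dots,W_k)$.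 Let $K:\mathbb U\to\mathbb R$ be convex, lower semicontinuous and Gateaux-differentiable on an open set containing $U^{ad}$, and assume that there are $b,L_K>0$ with $K(v)\ge K(u)+\langle\nabla K(u),v-u\rangle+\frac b2\|u-v\|^2$ and $\|\nabla K(v)-\nabla K(u)\|_*\le L_K\|v-u\|$ for all $u,v\in U^{ad}$. Let $\varepsilon_0>0$ and $\varepsilon_k=ck^{-\theta}$ for $k\ge1$, with $c>0$ and $\frac12<\theta<1$. Let $(U_k)_{k\in\mathbb N}$ be the iterates of the stochastic auxiliary problem principle algorithm: $U_0=u_0\in U^{ad}$ is deterministic and, for all $k\in\mathbb N$ and $\omega\in\Omega$, $$U_{k+1}(\omega)\in\operatorname*{arg\,min}_{u\in U^{ad}}\; K(u)+\big\langle \varepsilon_k\big(G_k(\omega)+R_k(\omega)\big)-\nabla K(U_k(\omega)),u\big\rangle+\varepsilon_k\, j^\Sigma(u,W_{k+1}(\omega)),$$ where $G_k,R_k:\Omega\to\mathbb U^*$ are $\mathcal F_{k+1}$-measurable and $G_k(\omega)\in\partial_u j^C(U_k(\omega),W_{k+1}(\omega))$ for all $\omega$. Assume that $(R_k)_k$ is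 almost surely bounded and that $\sum_{k\in\mathbb N}Q_k\varepsilon_k<\infty$, where $Q_k=\operatorname{ess\,sup}_\omega\|R_k(\omega)\|\in[0,\infty]$. Define, for $n\ge1$, $$\widetilde U_1^n=\sum_{k=1}^n\frac{\varepsilon_k}{\sum_{l=1}^n\varepsilon_l}\,U_k .$$ Then for every minimizer $u^*$ of $J$ over $U^{ad}$, the random variable $J(\widetilde U_1^n)-J(u^*)$ is integrable for every $n\ge1$ and $$\mathbb E\big[J(\widetilde U_1^n)-J(u^*)\big]=\mathcal O(n^{\theta-1})\qquad(n\to\infty).$$ In particular the rate can be brought arbitrarily close to $n^{-1/2}$: for every $\delta>0$, if $\theta\le\frac12+\delta$, then $\mathbb E[J(\widetilde U_1^n)-J(u^*)]=\mathcal O(n^{-1/2+\delta})$. Neither boundedness of $U^{ad}$ nor strong convexity of $J$ is assumed. -/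

import Mathlib

open Filter Topology MeasureTheory ProbabilityTheory Asymptotics Bornology
open scoped ENNReal

namespace StochAPP

noncomputable section

/-- The subdifferential `∂f(u)` of a real-valued function on a normed space: all continuous linear
forms `r` with `f v ≥ f u + ⟨r, v - u⟩` for every `v` of the space. -/
def subdiff {E : Type*} [NormedAddCommGroup E] [NormedSpace ℝ E] (f : E → ℝ) (u : E) :
    Set (StrongDual ℝ E) :=
  {r | ∀ v : E, f u + r (v - u) ≤ f v}

/-- `f` is Gateaux-differentiable at `u` with differential `L`, a continuous linear form: the
derivative of `f` at `u` in every direction `h` exists and equals `⟨L, h⟩`. -/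
def HasGateauxDerivAt {E : Type*} [NormedAddCommGroup E] [NormedSpace ℝ E] (f : E → ℝ)
    (L : StrongDual ℝ E) (u : E) : Prop :=
  ∀ h : E, HasLineDerivAt ℝ f (L h) u h

/-- The objective `J(u) = 𝔼[jC(u, W)] + 𝔼[jA(u, W)]`. -/
def objective {E Ω 𝕎 : Type*} [MeasurableSpace Ω] (μ : Measure Ω) (W : Ω → 𝕎)
    (jC jA : E → 𝕎 → ℝ) (u : E) : ℝ :=
  (∫ ω, jC u (W ω) ∂μ) + ∫ ω, jA u (W ω) ∂μ

/-- The objective of the auxiliary problem with step size `e`, (possibly biased) subgradient `p`,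
current point `x` with differential `dKx = ∇K(x)` of the auxiliary function, and sample `w`:
`u ↦ K(u) + ⟨e p - ∇K(x), u⟩ + e jA(u, w)`. -/
def auxObjective {E 𝕎 : Type*} [NormedAddCommGroup E] [NormedSpace ℝ E] (K : E → ℝ)
    (jA : E → 𝕎 → ℝ) (e : ℝ) (p dKx : StrongDual ℝ E) (w : 𝕎) (u : E) : ℝ :=
  K u + (e • p - dKx) u + e * jA u w

/-- The σ-field `𝓕ₖ = σ(W₁, …, Wₖ)` (so `𝓕₀` is trivial; the entry `W₀` is never used). -/
abbrev sampleSigma {Ω 𝕎 : Type*} [MeasurableSpace 𝕎] (W : ℕ → Ω → 𝕎) (k : ℕ) : MeasurableSpace Ω :=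
  ⨆ i ∈ Finset.Icc 1 k, MeasurableSpace.comap (W i) inferInstance

/-- `(Uₖ)` is a sequence of iterates of the stochastic auxiliary problem principle algorithm on the
feasible set `Uad`, started at `u₀`, with samples `W₁, W₂, …`, step sizes `ε`, stochastic
subgradients `Gₖ ∈ ∂jC(·, Wₖ₊₁)(Uₖ)` and additive errors `Rₖ`; `dK` is the differential of the
auxiliary function `K`. -/
structure IsAPPSequence {E Ω 𝕎 : Type*} [NormedAddCommGroup E] [NormedSpace ℝ E]
    (Uad : Set E) (K : E → ℝ) (dK : E → StrongDual ℝ E) (jC jA : E → 𝕎 → ℝ) (u₀ : E)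
    (W : ℕ → Ω → 𝕎) (ε : ℕ → ℝ) (G R : ℕ → Ω → StrongDual ℝ E) (U : ℕ → Ω → E) : Prop where
  init_mem : u₀ ∈ Uad
  init : ∀ ω, U 0 ω = u₀
  subgrad : ∀ k ω, G k ω ∈ subdiff (fun u => jC u (W (k + 1) ω)) (U k ω)
  step_mem : ∀ k ω, U (k + 1) ω ∈ Uad
  step_min : ∀ k ω,
    IsMinOn (auxObjective K jA (ε k) (G k ω + R k ω) (dK (U k ω)) (W (k + 1) ω)) Uad (U (k + 1) ω)

/-- The averaged iterate `Ũᵢⁿ = ∑_{k=i}^n (εₖ / ∑_{l=i}^n εₗ) Uₖ`. -/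
def averagedIterate {E Ω : Type*} [NormedAddCommGroup E] [NormedSpace ℝ E] (ε : ℕ → ℝ)
    (U : ℕ → Ω → E) (i n : ℕ) (ω : Ω) : E :=
  ∑ k ∈ Finset.Icc i n, (ε k / ∑ l ∈ Finset.Icc i n, ε l) • U k ω

end

end StochAPP

/-! The Lyapunov function is the Bregman distance ℓₖ = K(u*) - K(Uₖ) - ⟨∇K(Uₖ), u* - Uₖ⟩, which
dominates (b/2)‖Uₖ - u*‖². Testing the optimality condition of Uₖ₊₁ against u* and absorbing the
displacement Uₖ₊₁ - Uₖ by strong convexity of K (`bregman_step_le`) leaves an error εₖ² times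
squared subgradient norms, plus a bias term. Linear growth bounds these norms by ‖Uₖ - u*‖, hence by
ℓₖ itself, so no bounded feasible set is needed: ℓₖ₊₁ ≤ (1 + Aₖ)ℓₖ + Bₖ - εₖHₖ, where A and B are
summable because θ > 1/2 and ∑ Qₖεₖ < ∞.

Here Hₖ is the cost gap at Uₖ sampled with Wₖ₊₁. As Uₖ depends only on W₁, …, Wₖ
(`IsAPPSequence.measurable`), freezing it gives 𝔼[Hₖ] = 𝔼[J(Uₖ) - J(u*)] ≥ 0. The expected recursion
is deterministic, and `exists_sum_le_of_almost_supermartingale` bounds ∑ εₖ 𝔼[J(Uₖ) - J(u*)].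
Jensen's inequality and ∑_{k≤n} εₖ ≥ c n^{1-θ} then give the rate. -/

namespace StochAPP

/-! ### Convex analysis and the one-step Bregman estimate -/

section ConvexAnalysis

variable {E : Type*} [NormedAddCommGroup E] [NormedSpace ℝ E]

/-- A real-valued convex lower semicontinuous function on a Banach space is continuous. -/
theorem continuous_of_convexOn_of_lowerSemicontinuous [CompleteSpace E] {f : E → ℝ}
    (hf : ConvexOn ℝ Set.univ f) (hl : LowerSemicontinuous f) : Continuous f := by
  have hclosed : ∀ n : ℕ, IsClosed {x | f x ≤ n} := fun n => hl.isClosed_preimage (n : ℝ)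
  have hunion : ⋃ n : ℕ, {x | f x ≤ n} = Set.univ := by
    ext x
    simpa using exists_nat_ge (f x)
  -- Baire: some closed sublevel set has interior, so `f` is bounded above near a point, which for a
  -- convex function forces continuity.
  obtain ⟨n, x, hx⟩ := nonempty_interior_of_iUnion_of_closed hclosed hunion
  have htfae := hf.continuousOn_tfae isOpen_univ Set.univ_nonempty
  rw [← continuousOn_univ]
  have hbdd : ∃ x₀ ∈ Set.univ, (𝓝 x₀).IsBoundedUnder (· ≤ ·) f := by
    refine ⟨x, Set.mem_univ x, n, ?_⟩
    rw [eventually_map]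
    filter_upwards [mem_interior_iff_mem_nhds.1 hx] with y hy using hy
  exact (htfae.out 3 1).1 hbdd

/-- A continuous convex function is subdifferentiable everywhere. -/
theorem subdiff_nonempty {f : E → ℝ} (hf : ConvexOn ℝ Set.univ f) (hc : Continuous f) (u : E) :
    (subdiff f u).Nonempty := by
  have hconv : Convex ℝ {p : E × ℝ | p.1 ∈ Set.univ ∧ f p.1 < p.2} := hf.convex_strict_epigraph
  have hopen : IsOpen {p : E × ℝ | p.1 ∈ Set.univ ∧ f p.1 < p.2} := by
    simpa using isOpen_lt (hc.comp continuous_fst) continuous_snd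
  -- Separate (u, f u) from the open strict epigraph. The vertical coefficient φ(0, 1) is negative;
  -- normalizing it to -1 makes the horizontal part a subgradient.
  obtain ⟨φ, hφ⟩ := geometric_hahn_banach_open_point hconv hopen
    (x := (u, f u)) (by simp)
  have hsplit : ∀ (v : E) (t : ℝ), φ (v, t) = φ (v, 0) + t * φ (0, 1) := by
    intro v t
    have : ((v, t) : E × ℝ) = (v, 0) + t • (0, 1) := by simp
    rw [this, map_add, map_smul, smul_eq_mul]
  have hneg : φ (0, 1) < 0 := by
    have := hφ (u, f u + 1) (by simp)
    rw [hsplit u (f u + 1), hsplit u (f u)] at this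
    linarith
  refine ⟨(-(φ (0, 1))⁻¹) • φ.comp (ContinuousLinearMap.inl ℝ E ℝ), fun v => ?_⟩
  have hle : φ (v, f v) ≤ φ (u, f u) := by
    refine le_of_forall_pos_le_add fun δ hδ => ?_
    have := hφ (v, f v + δ / (-φ (0, 1))) (by simpa using div_pos hδ (neg_pos.2 hneg))
    rw [hsplit v] at this ⊢
    have h2 : δ / (-φ (0, 1)) * φ (0, 1) = -δ := by
      field_simp [hneg.ne]
    nlinarith
  rw [hsplit v, hsplit u] at hle
  have hsub : φ (v - u, 0) = φ (v, 0) - φ (u, 0) := by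
    rw [← map_sub]; simp
  have happ : ((-(φ (0, 1))⁻¹) • φ.comp (ContinuousLinearMap.inl ℝ E ℝ)) (v - u)
      = (φ (v, 0) - φ (u, 0)) / (-φ (0, 1)) := by
    simp [hsub, div_eq_inv_mul, inv_neg]
  rw [happ]
  have : (φ (v, 0) - φ (u, 0)) / (-φ (0, 1)) ≤ f v - f u := by
    rw [div_le_iff₀ (neg_pos.2 hneg)]
    nlinarith
  linarith

/-- The variational inequality satisfied by a minimizer of the auxiliary problem. -/
theorem auxObjective_variational_inequality {𝕎 : Type*} {Uad : Set E} (hconv : Convex ℝ Uad)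
    {K : E → ℝ} {jA : E → 𝕎 → ℝ} {e : ℝ} (he : 0 ≤ e) {p dKx dKy : StrongDual ℝ E} {w : 𝕎}
    (hjA : ConvexOn ℝ Set.univ fun u => jA u w) {y : E} (hy : y ∈ Uad)
    (hK : HasGateauxDerivAt K dKy y) (hmin : IsMinOn (auxObjective K jA e p dKx w) Uad y)
    {v : E} (hv : v ∈ Uad) :
    0 ≤ dKy (v - y) + (e • p - dKx) (v - y) + e * (jA v w - jA y w) := by
  have hslope := (hasDerivAt_iff_tendsto_slope_zero.1 (hK (v - y)))
  -- Only `K` is differentiated, along the segment from y to v; convexity bounds the increment of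
  -- `jA` by t (jA v - jA y), so no derivative of it is needed.
  have hslope' := (hslope.mono_left (nhdsGT_le_nhdsNE (0 : ℝ))).add_const
    ((e • p - dKx) (v - y) + e * (jA v w - jA y w))
  rw [add_assoc]
  refine ge_of_tendsto hslope' ?_
  filter_upwards [Ioo_mem_nhdsGT (zero_lt_one' ℝ)] with t ht
  have ht0 := ht.1
  have hcomb : y + t • (v - y) = (1 - t) • y + t • v := by
    rw [smul_sub, sub_smul, one_smul]; abel
  have hmem : y + t • (v - y) ∈ Uad := by
    rw [hcomb]; exact hconv hy hv (by linarith [ht.2]) ht0.le (by ring)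
  have hA : jA (y + t • (v - y)) w ≤ (1 - t) * jA y w + t * jA v w := by
    rw [hcomb]
    exact hjA.2 (Set.mem_univ y) (Set.mem_univ v) (by linarith [ht.2]) ht0.le (by ring)
  have hm := isMinOn_iff.1 hmin _ hmem
  simp only [auxObjective, map_add, map_smul, smul_eq_mul] at hm
  have hA' := mul_le_mul_of_nonneg_left hA he
  have key : 0 ≤ (K (y + t • (v - y)) - K y) + t * ((e • p - dKx) (v - y)
      + e * (jA v w - jA y w)) := by nlinarith
  simp only [zero_add, zero_smul, add_zero, smul_eq_mul]
  have := mul_nonneg (inv_nonneg.2 ht0.le) key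
  rw [mul_add, ← mul_assoc t⁻¹ t, inv_mul_cancel₀ ht0.ne', one_mul] at this
  exact this

/-- The Bregman distance `K(v) - K(u) - ⟨dK(u), v - u⟩`. -/
def bregman (K : E → ℝ) (dK : E → StrongDual ℝ E) (v u : E) : ℝ :=
  K v - K u - dK u (v - u)

/-- One step of the auxiliary problem principle, measured by the Bregman distance to `v`. -/
theorem bregman_step_le {K : E → ℝ} {dK : E → StrongDual ℝ E} {fC fA : E → ℝ} {b e : ℝ}
    (hb : 0 < b) (he : 0 ≤ e) {x y v : E} {g r s : StrongDual ℝ E}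
    (hstrong : K x + dK x (y - x) + b / 2 * ‖x - y‖ ^ 2 ≤ K y)
    (hg : g ∈ subdiff fC x) (hs : s ∈ subdiff fA x)
    (hvi : 0 ≤ dK y (v - y) + (e • (g + r) - dK x) (v - y) + e * (fA v - fA y)) :
    bregman K dK v y ≤ bregman K dK v x + e * (fC v + fA v - (fC x + fA x))
      + e ^ 2 / (2 * b) * (‖g‖ + ‖s‖ + ‖r‖) ^ 2 + e * (‖r‖ * ‖x - v‖) := by
  have hgv := hg v
  have hsy := hs y
  set d := ‖x - y‖
  have hgd : g (x - y) ≤ ‖g‖ * d := (le_abs_self _).trans (g.le_opNorm _)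
  have hrd : r (x - y) ≤ ‖r‖ * d := (le_abs_self _).trans (r.le_opNorm _)
  have hsd : s (x - y) ≤ ‖s‖ * d := (le_abs_self _).trans (s.le_opNorm _)
  have hrv : r (v - x) ≤ ‖r‖ * ‖x - v‖ := by
    rw [norm_sub_rev]; exact (le_abs_self _).trans (r.le_opNorm _)
  simp only [sub_apply, smul_apply,
    add_apply, smul_eq_mul, map_sub] at *
  -- Both costs are evaluated at x rather than y: g(v - y) = g(v - x) + g(x - y), and s, a
  -- subgradient at x, gives fA x - fA y ≤ s(x - y).
  have hsum : g v - g y + (r v - r y) + (fA v - fA y) ≤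
      (fC v + fA v - (fC x + fA x)) + (‖g‖ + ‖s‖ + ‖r‖) * d + ‖r‖ * ‖x - v‖ := by linarith
  have hsum' := mul_le_mul_of_nonneg_left hsum he
  -- Young's inequality, weighted so that its quadratic term is exactly the gain (b/2)d² from
  -- `hstrong`.
  have hyoung : e * ((‖g‖ + ‖s‖ + ‖r‖) * d) ≤
      e ^ 2 / (2 * b) * (‖g‖ + ‖s‖ + ‖r‖) ^ 2 + b / 2 * d ^ 2 := by
    have h0 : 0 ≤ (e * (‖g‖ + ‖s‖ + ‖r‖) - b * d) ^ 2 / (2 * b) := by positivity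
    have h1 : (e * (‖g‖ + ‖s‖ + ‖r‖) - b * d) ^ 2 / (2 * b) =
      e ^ 2 / (2 * b) * (‖g‖ + ‖s‖ + ‖r‖) ^ 2 + b / 2 * d ^ 2 - e * ((‖g‖ + ‖s‖ + ‖r‖) * d) := by
      field_simp
      ring
    linarith
  simp only [bregman, map_sub]
  nlinarith

/-- The one-step estimate with linearly growing subgradients and bounded error. -/
theorem bregman_step_le_of_linear_growth {K : E → ℝ} {dK : E → StrongDual ℝ E} {fC fA : E → ℝ}
    {b e α β ρ : ℝ} (hb : 0 < b) (he : 0 ≤ e) {x y v : E} {g r s : StrongDual ℝ E}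
    (hstrong : K x + dK x (y - x) + b / 2 * ‖x - y‖ ^ 2 ≤ K y)
    (hlower : b / 2 * ‖x - v‖ ^ 2 ≤ bregman K dK v x)
    (hg : g ∈ subdiff fC x) (hs : s ∈ subdiff fA x)
    (hgs : ‖g‖ + ‖s‖ ≤ α * ‖x - v‖ + β) (hr : ‖r‖ ≤ ρ)
    (hvi : 0 ≤ dK y (v - y) + (e • (g + r) - dK x) (v - y) + e * (fA v - fA y)) :
    bregman K dK v y ≤ (1 + 2 / b * (3 * α ^ 2 / (2 * b) * e ^ 2 + ρ * e)) * bregman K dK v x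
      + (3 * β ^ 2 / (2 * b) * e ^ 2 + 3 / (2 * b) * (ρ * e) ^ 2 + ρ * e)
      - e * (fC x + fA x - (fC v + fA v)) := by
  have h := bregman_step_le hb he hstrong hg hs hvi
  set D := ‖x - v‖
  have hD : 0 ≤ D := norm_nonneg _
  have hρ : 0 ≤ ρ := (norm_nonneg r).trans hr
  have h1 : (‖g‖ + ‖s‖ + ‖r‖) ^ 2 ≤ 3 * (α ^ 2 * D ^ 2 + β ^ 2 + ρ ^ 2) := by
    have : (‖g‖ + ‖s‖ + ‖r‖) ^ 2 ≤ (α * D + β + ρ) ^ 2 :=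
      pow_le_pow_left₀ (by positivity) (by linarith) 2
    nlinarith [sq_nonneg (α * D - β), sq_nonneg (α * D - ρ), sq_nonneg (β - ρ)]
  -- The bias is linear in D; D ≤ 1 + D² splits it into an additive term and one absorbed by the
  -- Bregman distance.
  have h2 : ‖r‖ * D ≤ ρ * (1 + D ^ 2) := by
    have : ‖r‖ * D ≤ ρ * D := mul_le_mul_of_nonneg_right hr hD
    have : D ≤ 1 + D ^ 2 := by nlinarith [sq_nonneg (D - 1)]
    nlinarith
  have h1' := mul_le_mul_of_nonneg_left h1 (show 0 ≤ e ^ 2 / (2 * b) by positivity)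
  have h2' := mul_le_mul_of_nonneg_left h2 he
  have h3 : D ^ 2 ≤ 2 / b * bregman K dK v x := by
    rw [div_mul_eq_mul_div, le_div_iff₀ hb]; linarith
  have h3' := mul_le_mul_of_nonneg_left h3
    (show 0 ≤ 3 * α ^ 2 / (2 * b) * e ^ 2 + ρ * e by positivity)
  have h4 : e ^ 2 / (2 * b) * (3 * (α ^ 2 * D ^ 2 + β ^ 2 + ρ ^ 2)) =
      3 * α ^ 2 / (2 * b) * e ^ 2 * D ^ 2 + 3 * β ^ 2 / (2 * b) * e ^ 2
        + 3 / (2 * b) * (ρ * e) ^ 2 := by ring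
  rw [h4] at h1'
  nlinarith

/-- A convex function whose subgradients are bounded on both ends satisfies a Lipschitz estimate. -/
theorem abs_sub_le_of_mem_subdiff {f : E → ℝ} {u v : E} {r s : StrongDual ℝ E} {M : ℝ}
    (hr : r ∈ subdiff f u) (hs : s ∈ subdiff f v) (hrM : ‖r‖ ≤ M) (hsM : ‖s‖ ≤ M) :
    |f u - f v| ≤ M * ‖u - v‖ := by
  have h1 := hr v
  have h2 := hs u
  have h3 : -(r (v - u)) ≤ M * ‖u - v‖ := by
    rw [← map_neg, neg_sub]
    exact (le_abs_self _).trans ((r.le_opNorm _).trans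
      (mul_le_mul_of_nonneg_right hrM (norm_nonneg _)))
  have h4 : -(s (u - v)) ≤ M * ‖u - v‖ := by
    rw [← map_neg, neg_sub, norm_sub_rev]
    exact (le_abs_self _).trans ((s.le_opNorm _).trans
      (mul_le_mul_of_nonneg_right hsM (norm_nonneg _)))
  rw [abs_le]
  constructor <;> linarith

end ConvexAnalysis

/-! ### Measurability of minimizers -/

section MeasurableSelection

variable {Ω E : Type*} [NormedAddCommGroup E] [MeasurableSpace E] [BorelSpace E]

/-- A point at which a measurable family of continuous functions attains its minimum over a set,
with quadratic growth, depends measurably on the parameter. -/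
theorem measurable_of_quadratic_growth [TopologicalSpace.SeparableSpace E]
    {m : MeasurableSpace Ω} {S : Set E} {Φ : Ω → E → ℝ} {y : Ω → E} {b : ℝ} (hb : 0 < b)
    (hmeas : ∀ v ∈ S, Measurable fun ω => Φ ω v) (hcont : ∀ ω, Continuous (Φ ω))
    (hyS : ∀ ω, y ω ∈ S) (hgrowth : ∀ ω, ∀ v ∈ S, b / 2 * ‖v - y ω‖ ^ 2 ≤ Φ ω v - Φ ω (y ω)) :
    Measurable y := by
  classical
  rcases isEmpty_or_nonempty Ω with hΩ | ⟨⟨ω₀⟩⟩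
  · exact measurable_of_empty y
  obtain ⟨C, hCS, hCc, hSC⟩ :=
    (TopologicalSpace.IsSeparable.of_separableSpace S).exists_countable_dense_subset
  have hCne : C.Nonempty := by
    by_contra h
    rw [Set.not_nonempty_iff_eq_empty] at h
    simpa [h] using hSC (hyS ω₀)
  obtain ⟨d, rfl⟩ := hCc.exists_eq_range hCne
  have hdS : ∀ i, d i ∈ S := fun i => hCS ⟨i, rfl⟩
  have happrox : ∀ ω, ∀ δ > 0, ∃ i, Φ ω (d i) < Φ ω (y ω) + δ := by
    intro ω δ hδ
    have hopen : IsOpen {v | Φ ω v < Φ ω (y ω) + δ} := isOpen_lt (hcont ω) continuous_const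
    obtain ⟨_, hv, i, rfl⟩ := mem_closure_iff.1 (hSC (hyS ω)) _ hopen (by simpa using hδ)
    exact ⟨i, hv⟩
  have hmin : ∀ ω, ∀ v ∈ S, Φ ω (y ω) ≤ Φ ω v := fun ω v hv => by
    have : 0 ≤ b / 2 * ‖v - y ω‖ ^ 2 := by positivity
    linarith [hgrowth ω v hv]
  -- Near-optimality is tested against the countable dense family only, hence is a measurable
  -- condition. The first near-optimal index gives a measurable approximation, and quadratic growth
  -- turns small excess value into small distance to `y`.
  let p : ℕ → Ω → ℕ → Prop := fun n ω i => ∀ j, Φ ω (d i) < Φ ω (d j) + 1 / ((n : ℝ) + 1)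
  have hp : ∀ n ω, ∃ i, p n ω i := fun n ω => by
    obtain ⟨i, hi⟩ := happrox ω (1 / ((n : ℝ) + 1)) (by positivity)
    exact ⟨i, fun j => hi.trans_le (by linarith [hmin ω (d j) (hdS j)])⟩
  have hpm : ∀ n i, MeasurableSet {ω | p n ω i} := fun n i => by
    simp only [p, Set.ofPred_forall]
    exact MeasurableSet.iInter fun j =>
      measurableSet_lt (hmeas _ (hdS i)) ((hmeas _ (hdS j)).add_const _)
  refine measurable_of_tendsto_metrizable (f := fun n ω => d (Nat.find (hp n ω)))
    (fun n => (measurable_from_nat (f := d)).comp (measurable_find (hp n) (hpm n))) ?_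
  rw [tendsto_pi_nhds]
  intro ω
  rw [tendsto_iff_norm_sub_tendsto_zero]
  have hbound : ∀ n : ℕ, ‖d (Nat.find (hp n ω)) - y ω‖ ^ 2 ≤ 2 / b * (1 / ((n : ℝ) + 1)) := by
    intro n
    have h1 : Φ ω (d (Nat.find (hp n ω))) ≤ Φ ω (y ω) + 1 / ((n : ℝ) + 1) := by
      refine le_of_forall_pos_le_add fun δ hδ => ?_
      obtain ⟨j, hj⟩ := happrox ω δ hδ
      have := Nat.find_spec (hp n ω) j
      linarith
    have h2 := hgrowth ω _ (hdS (Nat.find (hp n ω)))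
    rw [div_mul_eq_mul_div, le_div_iff₀ hb]
    linarith
  have hsq : Tendsto (fun n : ℕ => ‖d (Nat.find (hp n ω)) - y ω‖ ^ 2) atTop (𝓝 0) := by
    refine squeeze_zero (fun n => by positivity) hbound ?_
    simpa using tendsto_one_div_add_atTop_nhds_zero_nat.const_mul (2 / b)
  simpa [Real.sqrt_sq] using hsq.sqrt

/-- A function continuous on `S`, composed with a measurable map into `S`, is measurable. -/
theorem measurable_comp_of_continuousOn {F : Type*} [TopologicalSpace F] [MeasurableSpace F]
    [BorelSpace F] {m : MeasurableSpace Ω} {S : Set E} {f : E → F} (hf : ContinuousOn f S)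
    {y : Ω → E} (hy : Measurable y) (hyS : ∀ ω, y ω ∈ S) : Measurable fun ω => f (y ω) :=
  (continuousOn_iff_continuous_domRestrict.1 hf).measurable.comp (hy.subtype_mk (h := hyS))

end MeasurableSelection

/-! ### Deterministic sequences and step sizes -/

section Sequences

/-- A deterministic Robbins–Siegmund lemma. -/
theorem exists_sum_le_of_almost_supermartingale {x y a b : ℕ → ℝ} (hx : ∀ n, 0 ≤ x n)
    (hy : ∀ n, 0 ≤ y n) (ha : ∀ n, 0 ≤ a n) (hb : ∀ n, 0 ≤ b n) (hsa : Summable a)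
    (hsb : Summable b) (h : ∀ n, x (n + 1) + y n ≤ (1 + a n) * x n + b n) :
    ∃ C, ∀ n, ∑ k ∈ Finset.range n, y k ≤ C := by
  -- A discrete Gronwall bound makes `x` uniformly bounded; then a n * x n ≤ M * a n is a summable
  -- additive error and the recursion telescopes.
  have hbound : ∀ n, x n ≤ Real.exp (∑ k ∈ Finset.range n, a k)
      * (x 0 + ∑ k ∈ Finset.range n, b k) := by
    intro n
    induction n with
    | zero => simp
    | succ n ih =>
      rw [Finset.sum_range_succ, Finset.sum_range_succ, Real.exp_add]
      set A := Real.exp (∑ k ∈ Finset.range n, a k)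
      set B := x 0 + ∑ k ∈ Finset.range n, b k
      have hA : 1 ≤ A := Real.one_le_exp (Finset.sum_nonneg fun k _ => ha k)
      have hB : 0 ≤ B := add_nonneg (hx 0) (Finset.sum_nonneg fun k _ => hb k)
      have hexp : 1 + a n ≤ Real.exp (a n) := by linarith [Real.add_one_le_exp (a n)]
      have he1 : 1 ≤ Real.exp (a n) := Real.one_le_exp (ha n)
      calc x (n + 1) ≤ (1 + a n) * x n + b n := by linarith [h n, hy n]
        _ ≤ Real.exp (a n) * (A * B) + (A * Real.exp (a n)) * b n := by
          refine add_le_add (mul_le_mul hexp ih (hx n) (by positivity)) ?_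
          exact le_mul_of_one_le_left (hb n) (one_le_mul_of_one_le_of_one_le hA he1)
        _ = A * Real.exp (a n) * (x 0 + (∑ k ∈ Finset.range n, b k + b n)) := by
          simp only [B]; ring
  set M := Real.exp (∑' k, a k) * (x 0 + ∑' k, b k)
  have hM : ∀ n, x n ≤ M := fun n => (hbound n).trans <| by
    refine mul_le_mul (Real.exp_le_exp.2 (hsa.sum_le_tsum _ fun k _ => ha k)) ?_ ?_ (by positivity)
    · linarith [hsb.sum_le_tsum (Finset.range n) fun k _ => hb k]
    · exact add_nonneg (hx 0) (Finset.sum_nonneg fun k _ => hb k)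
  have hsum : ∀ n, x n + ∑ k ∈ Finset.range n, y k
      ≤ x 0 + ∑ k ∈ Finset.range n, (M * a k + b k) := by
    intro n
    induction n with
    | zero => simp
    | succ n ih =>
      rw [Finset.sum_range_succ, Finset.sum_range_succ]
      have := mul_le_mul_of_nonneg_left (hM n) (ha n)
      linarith [h n]
  have hs : Summable fun k => M * a k + b k := (hsa.mul_left M).add hsb
  have hM0 : 0 ≤ M := (hx 0).trans (hM 0)
  refine ⟨x 0 + ∑' k, (M * a k + b k), fun n => ?_⟩
  have := hs.sum_le_tsum (Finset.range n) fun k _ => add_nonneg (mul_nonneg hM0 (ha k)) (hb k)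
  linarith [hsum n, hx n]

/-- The square of a nonnegative summable sequence is summable. -/
theorem summable_sq_of_summable {q : ℕ → ℝ} (hq : ∀ n, 0 ≤ q n) (hs : Summable q) :
    Summable fun n => q n ^ 2 := by
  refine Summable.of_nonneg_of_le (fun n => sq_nonneg _) (fun n => ?_) (hs.mul_left (∑' k, q k))
  rw [sq]
  exact mul_le_mul_of_nonneg_right (hs.le_tsum n fun k _ => hq k) (hq n)

/-- The partial sums of `k ↦ c k^{-θ}` are at least `c n^{1-θ}`. -/
theorem rpow_le_sum_steps {c θ : ℝ} (hc : 0 < c) (hθ : 0 ≤ θ) {ε : ℕ → ℝ}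
    (hε : ∀ k : ℕ, 1 ≤ k → ε k = c * (k : ℝ) ^ (-θ)) {n : ℕ} (hn : 1 ≤ n) :
    c * (n : ℝ) ^ (1 - θ) ≤ ∑ k ∈ Finset.Icc 1 n, ε k := by
  have hn0 : (0 : ℝ) < n := by exact_mod_cast hn
  calc c * (n : ℝ) ^ (1 - θ) = ∑ k ∈ Finset.Icc 1 n, c * (n : ℝ) ^ (-θ) := by
        rw [Finset.sum_const, Nat.card_Icc, Nat.add_sub_cancel, nsmul_eq_mul, sub_eq_add_neg,
          Real.rpow_add hn0, Real.rpow_one]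
        ring
    _ ≤ _ := by
        refine Finset.sum_le_sum fun k hk => ?_
        rw [Finset.mem_Icc] at hk
        rw [hε k hk.1]
        refine mul_le_mul_of_nonneg_left ?_ hc.le
        exact Real.rpow_le_rpow_of_nonpos (by exact_mod_cast hk.1) (by exact_mod_cast hk.2)
          (by linarith)

/-- The squares of the steps `k ↦ c k^{-θ}` are summable for `θ > 1/2`. -/
theorem summable_sq_steps {c θ : ℝ} (hθ : 1 / 2 < θ) {ε : ℕ → ℝ}
    (hε : ∀ k : ℕ, 1 ≤ k → ε k = c * (k : ℝ) ^ (-θ)) : Summable fun k => ε k ^ 2 := by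
  -- The formula for `ε` starts at k = 1; `ε 0` is arbitrary.
  rw [← summable_nat_add_iff 1]
  have h : Summable fun k : ℕ => c ^ 2 * (k : ℝ) ^ (-(2 * θ)) :=
    (Real.summable_nat_rpow.2 (by linarith)).mul_left _
  refine ((summable_nat_add_iff 1).2 h).congr fun k => ?_
  rw [hε (k + 1) (by omega), mul_pow, ← Real.rpow_natCast (_ ^ _), ← Real.rpow_mul (by positivity)]
  congr 2
  push_cast
  ring

end Sequences

end StochAPP

namespace StochAPP

/-! ### Independence from the next sample -/

section Filtration

variable {Ω 𝕎 : Type*} [MeasurableSpace 𝕎]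

theorem sampleSigma_mono (W : ℕ → Ω → 𝕎) : Monotone (sampleSigma W) := fun _ _ h =>
  biSup_mono fun _ hi => Finset.Icc_subset_Icc_right h hi

theorem measurable_sampleSigma (W : ℕ → Ω → 𝕎) (k : ℕ) :
    Measurable[sampleSigma W (k + 1)] (W (k + 1)) :=
  (comap_measurable (W (k + 1))).mono
    (le_iSup₂_of_le (k + 1) (by simp) le_rfl) le_rfl

theorem sampleSigma_le [m : MeasurableSpace Ω] {W : ℕ → Ω → 𝕎}
    (hW : ∀ k, 1 ≤ k → Measurable (W k)) (k : ℕ) : sampleSigma W k ≤ m :=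
  iSup₂_le fun i hi => (hW i (Finset.mem_Icc.1 hi).1).comap_le

/-- A random variable measurable with respect to the first `k` samples is independent of the
next one. -/
theorem indepFun_of_measurable_sampleSigma {F : Type*} [MeasurableSpace F] [MeasurableSpace Ω]
    {μ : Measure Ω} {W : ℕ → Ω → 𝕎} (hW : ∀ k, 1 ≤ k → Measurable (W k))
    (hindep : iIndepFun (fun k : ℕ => W (k + 1)) μ) {k : ℕ} {X : Ω → F}
    (hX : Measurable[sampleSigma W k] X) : IndepFun X (W (k + 1)) μ := by
  -- The independent family is shifted by one: indices below k are the samples W₁, …, Wₖ, and index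
  -- k is Wₖ₊₁.
  have h := indep_iSup_of_disjoint (fun i => (hW (i + 1) (by omega)).comap_le)
    ((iIndepFun_iff_iIndep _ _ _).1 hindep) (S := Set.Iio k) (T := {k}) (by simp)
  rw [IndepFun_iff_Indep]
  refine indep_of_indep_of_le_left (indep_of_indep_of_le_right h ?_) ?_
  · simp
  · refine hX.comap_le.trans (iSup₂_le fun i hi => ?_)
    obtain ⟨h1, h2⟩ := Finset.mem_Icc.1 hi
    obtain ⟨j, rfl⟩ : ∃ j, i = j + 1 := ⟨i - 1, by omega⟩
    exact le_iSup₂_of_le (f := fun i (_ : i ∈ Set.Iio k) =>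
      MeasurableSpace.comap (W (i + 1)) inferInstance) j (Nat.lt_of_succ_le h2) le_rfl

end Filtration

/-! ### Freezing and the expected recursion -/

section Expectation

variable {Ω E 𝕎 : Type*} [MeasurableSpace Ω] {μ : Measure Ω} [IsProbabilityMeasure μ]
  [MeasurableSpace E] [MeasurableSpace 𝕎]

/-- Freezing an independent variable: `𝔼[f(X, Y)] = 𝔼[g(X)]` with `g(x) = 𝔼[f(x, W)]`, when `Y` is
independent of `X` and has the law of `W`. -/
theorem integrable_and_integral_of_indepFun {X : Ω → E} {Y W : Ω → 𝕎} (hX : Measurable X)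
    (hY : Measurable Y) (hlaw : IdentDistrib Y W μ μ) (hind : IndepFun X Y μ) {f : E → 𝕎 → ℝ}
    (hf : Measurable (Function.uncurry f)) (hint : Integrable (fun ω => f (X ω) (Y ω)) μ) :
    Integrable (fun ω => ∫ ω', f (X ω) (W ω') ∂μ) μ ∧
      ∫ ω, f (X ω) (Y ω) ∂μ = ∫ ω, ∫ ω', f (X ω) (W ω') ∂μ ∂μ := by
  have hXY : Measurable fun ω => (X ω, Y ω) := hX.prodMk hY
  -- With a product law, Fubini does the work of conditional expectation.
  have hprod : μ.map (fun ω => (X ω, Y ω)) = (μ.map X).prod (μ.map W) := by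
    rw [(indepFun_iff_map_prod_eq_prod_map_map hX.aemeasurable hY.aemeasurable).1 hind,
      hlaw.map_eq]
  have : IsProbabilityMeasure (μ.map X) := Measure.isProbabilityMeasure_map hX.aemeasurable
  have : IsProbabilityMeasure (μ.map W) :=
    Measure.isProbabilityMeasure_map hlaw.aemeasurable_snd
  have hinner : ∀ x, ∫ w, f x w ∂(μ.map W) = ∫ ω', f x (W ω') ∂μ := fun x =>
    integral_map hlaw.aemeasurable_snd (hf.comp measurable_prodMk_left).aestronglyMeasurable
  have hint' : Integrable (Function.uncurry f) ((μ.map X).prod (μ.map W)) := by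
    rw [← hprod, integrable_map_measure hf.aestronglyMeasurable hXY.aemeasurable]
    exact hint
  have hsm : StronglyMeasurable fun x => ∫ w, f x w ∂(μ.map W) :=
    hf.stronglyMeasurable.integral_prod_right
  simp only [← hinner]
  constructor
  · have h := hint'.integral_prod_left
    exact (integrable_map_measure hsm.aestronglyMeasurable hX.aemeasurable).1 h
  · have h1 : ∫ ω, f (X ω) (Y ω) ∂μ = ∫ z, Function.uncurry f z ∂(μ.map fun ω => (X ω, Y ω)) :=
      (integral_map hXY.aemeasurable hf.aestronglyMeasurable).symm
    rw [h1, hprod, integral_prod _ hint']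
    exact integral_map hX.aemeasurable hsm.aestronglyMeasurable

/-- Taking expectations in a pathwise almost-supermartingale inequality. -/
theorem integrable_and_integral_of_almost_supermartingale {ℓ H : ℕ → Ω → ℝ} {a b e : ℕ → ℝ}
    {C : ℝ} (hℓm : ∀ k, Measurable (ℓ k)) (hHm : ∀ k, Measurable (H k)) (hℓ : ∀ k ω, 0 ≤ ℓ k ω)
    (hℓ0 : Integrable (ℓ 0) μ) (hH : ∀ k ω, |H k ω| ≤ C * (1 + ℓ k ω))
    (h : ∀ k, ∀ᵐ ω ∂μ, ℓ (k + 1) ω ≤ (1 + a k) * ℓ k ω + b k - e k * H k ω) (k : ℕ) :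
    Integrable (H k) μ ∧
      ∫ ω, ℓ (k + 1) ω ∂μ + e k * ∫ ω, H k ω ∂μ ≤ (1 + a k) * ∫ ω, ℓ k ω ∂μ + b k := by
  have hHint : ∀ k, Integrable (ℓ k) μ → Integrable (H k) μ := fun k hk =>
    (((integrable_const (1 : ℝ)).add hk).const_mul C).mono' (hHm k).aestronglyMeasurable
      (ae_of_all _ fun ω => hH k ω)
  have hrhs : ∀ k, Integrable (ℓ k) μ →
      Integrable (fun ω => (1 + a k) * ℓ k ω + b k - e k * H k ω) μ := fun k hk =>
    ((hk.const_mul _).add (integrable_const _)).sub ((hHint k hk).const_mul _)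
  -- Integrability propagates from ℓ 0 through the recursion, since |H k| is controlled by 1 + ℓ k.
  have hℓint : ∀ k, Integrable (ℓ k) μ := by
    intro k
    induction k with
    | zero => exact hℓ0
    | succ k ih =>
      refine (hrhs k ih).mono' (hℓm (k + 1)).aestronglyMeasurable ?_
      filter_upwards [h k] with ω hω
      rwa [Real.norm_of_nonneg (hℓ _ _)]
  refine ⟨hHint k (hℓint k), ?_⟩
  have hmono := integral_mono_ae (hℓint (k + 1)) (hrhs k (hℓint k)) (h k)
  have hI : ∫ ω, ((1 + a k) * ℓ k ω + b k - e k * H k ω) ∂μ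
      = (1 + a k) * ∫ ω, ℓ k ω ∂μ + b k - e k * ∫ ω, H k ω ∂μ := by
    have h1 : Integrable (fun ω => (1 + a k) * ℓ k ω) μ := (hℓint k).const_mul _
    have h2 : Integrable (fun ω => (1 + a k) * ℓ k ω + b k) μ := h1.add (integrable_const _)
    rw [integral_sub h2 ((hHint k (hℓint k)).const_mul _), integral_add h1 (integrable_const _),
      integral_const_mul, integral_const_mul]
    simp
  linarith

end Expectation

/-! ### Jensen's inequality for the averages -/

section Averaging

variable {Ω E : Type*} [MeasurableSpace Ω] {μ : Measure Ω}
  [NormedAddCommGroup E] [NormedSpace ℝ E]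

/-- Jensen's inequality for the averaged iterate, in expectation. -/
theorem integrable_and_integral_averagedIterate_le {S : Set E} {J : E → ℝ} {Jmin : ℝ}
    (hJ : ConvexOn ℝ S J) (hmin : ∀ u ∈ S, Jmin ≤ J u) {ε : ℕ → ℝ} (hε : ∀ k, 0 < ε k)
    {U : ℕ → Ω → E} (hU : ∀ k ω, U k ω ∈ S) (hint : ∀ k, Integrable (fun ω => J (U k ω) - Jmin) μ)
    {n : ℕ} (hn : 1 ≤ n) (hmeas : AEStronglyMeasurable (fun ω => J (averagedIterate ε U 1 n ω)) μ) :
    Integrable (fun ω => J (averagedIterate ε U 1 n ω) - Jmin) μ ∧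
      0 ≤ ∫ ω, (J (averagedIterate ε U 1 n ω) - Jmin) ∂μ ∧
      ∫ ω, (J (averagedIterate ε U 1 n ω) - Jmin) ∂μ ≤
        (∑ k ∈ Finset.Icc 1 n, ε k * ∫ ω, (J (U k ω) - Jmin) ∂μ) / ∑ k ∈ Finset.Icc 1 n, ε k := by
  set s := ∑ k ∈ Finset.Icc 1 n, ε k
  have hspos : 0 < s := Finset.sum_pos (fun k _ => hε k) ⟨1, by simp [hn]⟩
  have hw0 : ∀ k ∈ Finset.Icc 1 n, 0 ≤ ε k / s := fun k _ => (div_pos (hε k) hspos).le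
  have hw1 : ∑ k ∈ Finset.Icc 1 n, ε k / s = 1 := by
    rw [← Finset.sum_div, div_self hspos.ne']
  have hmem : ∀ ω, averagedIterate ε U 1 n ω ∈ S := fun ω =>
    hJ.1.sum_mem hw0 hw1 fun k _ => hU k ω
  have hnonneg : ∀ ω, 0 ≤ J (averagedIterate ε U 1 n ω) - Jmin := fun ω =>
    sub_nonneg.2 (hmin _ (hmem ω))
  have hjensen : ∀ ω, J (averagedIterate ε U 1 n ω) - Jmin
      ≤ ∑ k ∈ Finset.Icc 1 n, ε k / s * (J (U k ω) - Jmin) := by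
    intro ω
    have h := hJ.map_sum_le hw0 hw1 fun k _ => hU k ω
    simp only [mul_sub, Finset.sum_sub_distrib, ← Finset.sum_mul, hw1, one_mul]
    simpa [averagedIterate] using h
  have hsum : Integrable (fun ω => ∑ k ∈ Finset.Icc 1 n, ε k / s * (J (U k ω) - Jmin)) μ :=
    integrable_finsetSum _ fun k _ => (hint k).const_mul _
  have hI : Integrable (fun ω => J (averagedIterate ε U 1 n ω) - Jmin) μ :=
    hsum.mono' (hmeas.sub aestronglyMeasurable_const) (ae_of_all _ fun ω => by
      rw [Real.norm_of_nonneg (hnonneg ω)]; exact hjensen ω)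
  refine ⟨hI, integral_nonneg hnonneg, (integral_mono hI hsum hjensen).trans_eq ?_⟩
  rw [integral_finsetSum _ fun k _ => (hint k).const_mul _, Finset.sum_div]
  refine Finset.sum_congr rfl fun k _ => ?_
  rw [integral_const_mul]
  ring

end Averaging

/-! ### Growth and convexity of the costs -/

section Integrands

variable {E 𝕎 : Type*} [NormedAddCommGroup E] [NormedSpace ℝ E]

/-- A cost with linearly growing subgradients grows at most quadratically away from a point. -/
theorem abs_sub_le_of_linear_growth {S : Set E} {j : E → 𝕎 → ℝ} {c₁ c₂ : ℝ} (hc₁ : 0 < c₁)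
    (hc₂ : 0 < c₂) (hne : ∀ u ∈ S, ∀ w, (subdiff (fun v => j v w) u).Nonempty)
    (hbdd : ∀ u ∈ S, ∀ w, ∀ r ∈ subdiff (fun v => j v w) u, ‖r‖ ≤ c₁ * ‖u‖ + c₂)
    {x v : E} (hx : x ∈ S) (hv : v ∈ S) (w : 𝕎) :
    |j x w - j v w| ≤ (2 * c₁ + 2 * c₁ * ‖v‖ + c₂) * (1 + ‖x - v‖ ^ 2) := by
  obtain ⟨r, hr⟩ := hne x hx w
  obtain ⟨s, hs⟩ := hne v hv w
  have hxv : ‖x‖ ≤ ‖x - v‖ + ‖v‖ := by simpa using norm_add_le (x - v) v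
  have hD := norm_nonneg (x - v)
  have hv0 := norm_nonneg v
  -- This `M` dominates the subgradient bounds at both x and v.
  have h := abs_sub_le_of_mem_subdiff (M := c₁ * ‖x - v‖ + 2 * c₁ * ‖v‖ + c₂) hr hs
    ((hbdd x hx w r hr).trans (by nlinarith)) ((hbdd v hv w s hs).trans (by nlinarith))
  refine h.trans ?_
  have h1 : ‖x - v‖ ≤ 1 + ‖x - v‖ ^ 2 := by nlinarith [sq_nonneg (‖x - v‖ - 1)]
  have h2 : 0 ≤ 2 * c₁ * ‖v‖ + c₂ := by positivity
  nlinarith [mul_le_mul_of_nonneg_left h1 h2]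

/-- The expectation of a convex integrand is convex. -/
theorem convexOn_integral {Ω : Type*} [MeasurableSpace Ω] {μ : Measure Ω} {S : Set E} {f : E → 𝕎 → ℝ}
    {W : Ω → 𝕎} (hS : Convex ℝ S) (hf : ∀ w, ConvexOn ℝ Set.univ fun u => f u w)
    (hint : ∀ u ∈ S, Integrable (fun ω => f u (W ω)) μ) :
    ConvexOn ℝ S fun u => ∫ ω, f u (W ω) ∂μ := by
  refine ⟨hS, fun x hx y hy s t hs ht hst => ?_⟩
  have h := integral_mono (hint _ (hS hx hy hs ht hst))
    (((hint x hx).const_mul s).add ((hint y hy).const_mul t))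
    (fun ω => (hf (W ω)).2 (Set.mem_univ x) (Set.mem_univ y) hs ht hst)
  have h2 : ∫ ω, ((fun ω => s * f x (W ω)) + fun ω => t * f y (W ω)) ω ∂μ
      = s • (∫ ω, f x (W ω) ∂μ) + t • ∫ ω, f y (W ω) ∂μ := by
    rw [integral_add' ((hint x hx).const_mul s) ((hint y hy).const_mul t), integral_const_mul,
      integral_const_mul, smul_eq_mul, smul_eq_mul]
  exact h.trans h2.le

end Integrands

/-! ### Adaptedness of the iterates -/

section Algorithm

variable {Ω E 𝕎 : Type*} [NormedAddCommGroup E] [NormedSpace ℝ E]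
  {Uad : Set E} {K : E → ℝ} {dK : E → StrongDual ℝ E}
  {jC jA : E → 𝕎 → ℝ} {u₀ : E} {Ws : ℕ → Ω → 𝕎} {ε : ℕ → ℝ} {G R : ℕ → Ω → StrongDual ℝ E}
  {U : ℕ → Ω → E}

theorem IsAPPSequence.mem (h : IsAPPSequence Uad K dK jC jA u₀ Ws ε G R U) (k : ℕ) (ω : Ω) :
    U k ω ∈ Uad := by
  cases k with
  | zero => rw [h.init]; exact h.init_mem
  | succ k => exact h.step_mem k ω

/-- The variational inequality along the iterates. -/
theorem IsAPPSequence.variational_inequality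
    (h : IsAPPSequence Uad K dK jC jA u₀ Ws ε G R U) (hconv : Convex ℝ Uad)
    (hjA : ∀ w, ConvexOn ℝ Set.univ fun u => jA u w) (hε : ∀ k, 0 < ε k)
    (hK : ∀ u ∈ Uad, HasGateauxDerivAt K (dK u) u) (k : ℕ) (ω : Ω) {v : E} (hv : v ∈ Uad) :
    0 ≤ dK (U (k + 1) ω) (v - U (k + 1) ω) + (ε k • (G k ω + R k ω) - dK (U k ω)) (v - U (k + 1) ω)
      + ε k * (jA v (Ws (k + 1) ω) - jA (U (k + 1) ω) (Ws (k + 1) ω)) :=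
  auxObjective_variational_inequality hconv (hε k).le (hjA _) (h.step_mem k ω)
    (hK _ (h.step_mem k ω)) (h.step_min k ω) hv

/-- The iterate `Uₖ` is a measurable function of the first `k` samples. -/
theorem IsAPPSequence.measurable [MeasurableSpace E] [BorelSpace E]
    [TopologicalSpace.SeparableSpace E] [TopologicalSpace.SeparableSpace (StrongDual ℝ E)]
    [MeasurableSpace 𝕎] (h : IsAPPSequence Uad K dK jC jA u₀ Ws ε G R U) (hconv : Convex ℝ Uad)
    (hjA : ∀ w, ConvexOn ℝ Set.univ fun u => jA u w) (hε : ∀ k, 0 < ε k)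
    (hK : ∀ u ∈ Uad, HasGateauxDerivAt K (dK u) u) (hKcont : Continuous K)
    (hdK : ContinuousOn dK Uad) (hjAcont : ∀ w, Continuous fun u => jA u w)
    (hjAmeas : ∀ u, Measurable (jA u)) {b : ℝ} (hb : 0 < b)
    (hstrong : ∀ u ∈ Uad, ∀ v ∈ Uad, K u + dK u (v - u) + b / 2 * ‖u - v‖ ^ 2 ≤ K v)
    (hG : ∀ k, Measurable[sampleSigma Ws (k + 1)] (G k))
    (hR : ∀ k, Measurable[sampleSigma Ws (k + 1)] (R k)) (k : ℕ) :
    Measurable[sampleSigma Ws k] (U k) := by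
  -- Makes addition and subtraction on the dual Borel measurable.
  have : SecondCountableTopology (StrongDual ℝ E) :=
    UniformSpace.secondCountable_of_separable _
  induction k with
  | zero =>
    rw [funext h.init]
    exact measurable_const
  | succ k ih =>
    have hUk : Measurable[sampleSigma Ws (k + 1)] (U k) :=
      ih.mono (sampleSigma_mono Ws k.le_succ) le_rfl
    have hdKU : Measurable[sampleSigma Ws (k + 1)] fun ω => dK (U k ω) :=
      measurable_comp_of_continuousOn hdK hUk (h.mem k)
    refine measurable_of_quadratic_growth hb (S := Uad) (Φ := fun ω =>
      auxObjective K jA (ε k) (G k ω + R k ω) (dK (U k ω)) (Ws (k + 1) ω)) ?_ ?_ (h.mem (k + 1)) ?_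
    · intro v _
      have hlin : Measurable[sampleSigma Ws (k + 1)]
          fun ω => (ε k • (G k ω + R k ω) - dK (U k ω)) v :=
        (ContinuousLinearMap.apply ℝ ℝ v).continuous.measurable.comp
          ((((hG k).add (hR k)).const_smul (ε k)).sub hdKU)
      exact (hlin.const_add (K v)).add
        (((hjAmeas v).comp (measurable_sampleSigma Ws k)).const_mul (ε k))
    · intro ω
      exact (hKcont.add (ContinuousLinearMap.continuous _)).add
        (continuous_const.mul (hjAcont _))
    · intro ω v hv
      -- Quadratic growth of the auxiliary objective: the variational inequality plus strong
      -- convexity of `K` at the new iterate.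
      have hvi := h.variational_inequality hconv hjA hε hK k ω hv
      have hs := hstrong _ (h.step_mem k ω) v hv
      rw [norm_sub_rev]
      simp only [auxObjective]
      rw [map_sub (ε k • (G k ω + R k ω) - dK (U k ω))] at hvi
      linarith

end Algorithm

end StochAPP

/-! ### Assembly of the rate -/

theorem mainTheorem3
    -- the probability space, the separable reflexive Banach space with separable dual,
    -- and the sample space
    {Ω E 𝕎 : Type*} [MeasurableSpace Ω] (μ : Measure Ω) [IsProbabilityMeasure μ] [μ.IsComplete]
    [NormedAddCommGroup E] [NormedSpace ℝ E] [CompleteSpace E]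
    [TopologicalSpace.SeparableSpace E] [MeasurableSpace E] [BorelSpace E]
    (hreflexive : Function.Surjective (NormedSpace.inclusionInDoubleDual ℝ E))
    [TopologicalSpace.SeparableSpace (StrongDual ℝ E)]
    [TopologicalSpace 𝕎] [MeasurableSpace 𝕎] [BorelSpace 𝕎]
    -- the feasible set
    (Uad : Set E) (hUad_ne : Uad.Nonempty) (hUad_closed : IsClosed Uad) (hUad_conv : Convex ℝ Uad)
    -- the two parts of the random cost
    (jC jA : E → 𝕎 → ℝ)
    (hjC_lsc : LowerSemicontinuous (Function.uncurry jC))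
    (hjA_lsc : LowerSemicontinuous (Function.uncurry jA))
    (hjC_conv : ∀ w, ConvexOn ℝ Set.univ (fun u => jC u w))
    (hjA_conv : ∀ w, ConvexOn ℝ Set.univ (fun u => jA u w))
    (hjC_subdiff : ∀ w, ∃ O : Set E, IsOpen O ∧ Uad ⊆ O ∧
      ∀ u ∈ O, (StochAPP.subdiff (fun v => jC v w) u).Nonempty)
    (hjC_bdd : ∃ c₁ > (0 : ℝ), ∃ c₂ > (0 : ℝ), ∀ u ∈ Uad, ∀ w : 𝕎,
      ∀ r ∈ StochAPP.subdiff (fun v => jC v w) u, ‖r‖ ≤ c₁ * ‖u‖ + c₂)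
    (hjA_bdd : ∃ d₁ > (0 : ℝ), ∃ d₂ > (0 : ℝ), ∀ u ∈ Uad, ∀ w : 𝕎,
      ∀ s ∈ StochAPP.subdiff (fun v => jA v w) u, ‖s‖ ≤ d₁ * ‖u‖ + d₂)
    -- the random variable and its independent copies `W₁, W₂, …`
    (W : Ω → 𝕎) (hW : Measurable W)
    (Ws : ℕ → Ω → 𝕎) (hWs : ∀ k, 1 ≤ k → Measurable (Ws k))
    (hWs_law : ∀ k, 1 ≤ k → IdentDistrib (Ws k) W μ μ)
    (hWs_indep : iIndepFun (fun k : ℕ => Ws (k + 1)) μ)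
    -- the objective is well defined and coercive on the feasible set
    (hjC_int : ∀ u ∈ Uad, Integrable (fun ω => jC u (W ω)) μ)
    (hjA_int : ∀ u ∈ Uad, Integrable (fun ω => jA u (W ω)) μ)
    (hJ_coercive : Tendsto (StochAPP.objective μ W jC jA) (cobounded E ⊓ 𝓟 Uad) atTop)
    -- the auxiliary function
    (K : E → ℝ) (dK : E → StrongDual ℝ E)
    (hK_conv : ConvexOn ℝ Set.univ K) (hK_lsc : LowerSemicontinuous K)
    (hK_diff : ∃ O : Set E, IsOpen O ∧ Uad ⊆ O ∧ ∀ u ∈ O, StochAPP.HasGateauxDerivAt K (dK u) u)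
    (b L : ℝ) (hb : 0 < b) (hL : 0 < L)
    (hK_strong : ∀ u ∈ Uad, ∀ v ∈ Uad, K u + dK u (v - u) + b / 2 * ‖u - v‖ ^ 2 ≤ K v)
    (hK_lip : ∀ u ∈ Uad, ∀ v ∈ Uad, ‖dK v - dK u‖ ≤ L * ‖v - u‖)
    -- the step sizes
    (c θ : ℝ) (hc : 0 < c) (hθ : 1 / 2 < θ) (hθ' : θ < 1)
    (ε : ℕ → ℝ) (hε_pos : ∀ k, 0 < ε k) (hε : ∀ k : ℕ, 1 ≤ k → ε k = c * (k : ℝ) ^ (-θ))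
    -- the algorithm, with stochastic subgradients `G` and additive errors `R`
    (u₀ : E) (G R : ℕ → Ω → StrongDual ℝ E) (U : ℕ → Ω → E)
    (hAPP : StochAPP.IsAPPSequence Uad K dK jC jA u₀ Ws ε G R U)
    (hG : ∀ k, Measurable[StochAPP.sampleSigma Ws (k + 1)] (G k))
    (hR : ∀ k, Measurable[StochAPP.sampleSigma Ws (k + 1)] (R k))
    (hR_bdd : ∀ᵐ ω ∂μ, BddAbove (Set.range fun k => ‖R k ω‖))
    (hR_sum : ∑' k, essSup (fun ω => ‖R k ω‖ₑ) μ * ENNReal.ofReal (ε k) < ∞)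
    -- a minimizer of the objective over the feasible set
    (ustar : E) (hustar : ustar ∈ Uad)
    (hmin : IsMinOn (StochAPP.objective μ W jC jA) Uad ustar) :
    (∀ n, 1 ≤ n → Integrable
      (fun ω => StochAPP.objective μ W jC jA (StochAPP.averagedIterate ε U 1 n ω)
        - StochAPP.objective μ W jC jA ustar) μ) ∧
    (fun n : ℕ => ∫ ω, (StochAPP.objective μ W jC jA (StochAPP.averagedIterate ε U 1 n ω)
        - StochAPP.objective μ W jC jA ustar) ∂μ) =O[atTop] (fun n : ℕ => (n : ℝ) ^ (θ - 1)) ∧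
    (∀ δ > (0 : ℝ), θ ≤ 1 / 2 + δ →
      (fun n : ℕ => ∫ ω, (StochAPP.objective μ W jC jA (StochAPP.averagedIterate ε U 1 n ω)
        - StochAPP.objective μ W jC jA ustar) ∂μ) =O[atTop]
          (fun n : ℕ => (n : ℝ) ^ (-(1 / 2 : ℝ) + δ))) := by
  obtain ⟨c₁, hc₁, c₂, hc₂, hjC_bdd⟩ := hjC_bdd
  obtain ⟨d₁, hd₁, d₂, hd₂, hjA_bdd⟩ := hjA_bdd
  obtain ⟨O, -, hUO, hKO⟩ := hK_diff
  have hK_diff' : ∀ u ∈ Uad, StochAPP.HasGateauxDerivAt K (dK u) u := fun u hu => hKO u (hUO hu)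
  -- Open sets of E × 𝕎 then lie in the product σ-field, although 𝕎 is arbitrary; joint
  -- semicontinuity thus gives joint measurability.
  have : SecondCountableTopology E := UniformSpace.secondCountable_of_separable E
  -- regularity of the data
  have hjCm : Measurable (Function.uncurry jC) := hjC_lsc.measurable
  have hjAm : Measurable (Function.uncurry jA) := hjA_lsc.measurable
  have hjA_cont : ∀ w, Continuous fun u => jA u w := fun w =>
    StochAPP.continuous_of_convexOn_of_lowerSemicontinuous (hjA_conv w)
      (LowerSemicontinuous.comp hjA_lsc (Continuous.prodMk_left w))
  have hK_cont := StochAPP.continuous_of_convexOn_of_lowerSemicontinuous hK_conv hK_lsc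
  have hdK_cont : ContinuousOn dK Uad := by
    refine (LipschitzOnWith.of_dist_le_mul (K := L.toNNReal) fun u hu v hv => ?_).continuousOn
    rw [dist_eq_norm, dist_eq_norm, Real.coe_toNNReal _ hL.le]
    exact hK_lip v hv u hu
  have hjC_ne : ∀ u ∈ Uad, ∀ w, (StochAPP.subdiff (fun v => jC v w) u).Nonempty := fun u hu w => by
    obtain ⟨O', -, hO', h⟩ := hjC_subdiff w
    exact h u (hO' hu)
  have hjA_ne : ∀ u ∈ Uad, ∀ w, (StochAPP.subdiff (fun v => jA v w) u).Nonempty := fun u _ w =>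
    StochAPP.subdiff_nonempty (hjA_conv w) (hjA_cont w) u
  have hUmem := hAPP.mem
  have hUσ := hAPP.measurable hUad_conv hjA_conv hε_pos hK_diff' hK_cont hdK_cont hjA_cont
    (fun u => hjAm.comp measurable_prodMk_left) hb hK_strong hG hR
  have hUm : ∀ k, Measurable (U k) := fun k =>
    (hUσ k).mono (StochAPP.sampleSigma_le hWs k) le_rfl
  -- the objective
  set J := StochAPP.objective μ W jC jA
  have hJ_conv : ConvexOn ℝ Uad J :=
    (StochAPP.convexOn_integral hUad_conv hjC_conv hjC_int).add
      (StochAPP.convexOn_integral hUad_conv hjA_conv hjA_int)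
  have hJ_meas : Measurable J := by
    have h : ∀ {j : E → 𝕎 → ℝ}, Measurable (Function.uncurry j) →
        Measurable fun u => ∫ ω, j u (W ω) ∂μ := fun {j} hj =>
      ((hj.comp (measurable_fst.prodMk (hW.comp measurable_snd))).stronglyMeasurable
        (f := Function.uncurry fun u ω => j u (W ω))).integral_prod_right.measurable
    exact (h hjCm).add (h hjAm)
  have hJ_min : ∀ u ∈ Uad, J ustar ≤ J u := isMinOn_iff.1 hmin
  -- the gap between the sampled costs at a point and at the minimizer
  let f : E → 𝕎 → ℝ := fun x w => jC x w + jA x w - (jC ustar w + jA ustar w)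
  have hf_meas : Measurable (Function.uncurry f) := by
    have hstar : Measurable fun z : E × 𝕎 => (ustar, z.2) := measurable_const.prodMk measurable_snd
    exact (hjCm.add hjAm).sub ((hjCm.comp hstar).add (hjAm.comp hstar))
  have hf_int : ∀ x ∈ Uad, ∫ ω, f x (W ω) ∂μ = J x - J ustar := fun x hx => by
    have hsum : ∀ u ∈ Uad, Integrable (fun ω => jC u (W ω) + jA u (W ω)) μ := fun u hu =>
      (hjC_int u hu).add (hjA_int u hu)
    simp only [f]
    rw [integral_sub (hsum x hx) (hsum _ hustar), integral_add (hjC_int x hx) (hjA_int x hx),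
      integral_add (hjC_int _ hustar) (hjA_int _ hustar)]
    rfl
  -- the Bregman distance of the iterates to the minimizer
  let ℓ : ℕ → Ω → ℝ := fun k ω => StochAPP.bregman K dK ustar (U k ω)
  have hℓ_lower : ∀ x ∈ Uad, b / 2 * ‖x - ustar‖ ^ 2 ≤ StochAPP.bregman K dK ustar x :=
    fun x hx => by
      have := hK_strong x hx ustar hustar
      simp only [StochAPP.bregman]
      linarith
  have hℓ_nonneg : ∀ k ω, 0 ≤ ℓ k ω := fun k ω =>
    le_trans (by positivity) (hℓ_lower _ (hUmem k ω))
  have hℓ_meas : ∀ k, Measurable (ℓ k) := fun k =>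
    StochAPP.measurable_comp_of_continuousOn (f := StochAPP.bregman K dK ustar)
      ((continuousOn_const.sub hK_cont.continuousOn).sub
        (hdK_cont.clm_apply (continuousOn_const.sub continuousOn_id))) (hUm k) (hUmem k)
  have hℓ_int : Integrable (ℓ 0) μ := by
    simp only [ℓ, hAPP.init]
    exact integrable_const _
  -- `H k` may be negative pointwise; only its expectation is nonnegative.
  let H : ℕ → Ω → ℝ := fun k ω => f (U k ω) (Ws (k + 1) ω)
  have hWm : ∀ k, Measurable (Ws (k + 1)) := fun k => hWs (k + 1) (by omega)
  have hH_meas : ∀ k, Measurable (H k) := fun k => hf_meas.comp ((hUm k).prodMk (hWm k))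
  obtain ⟨C₀, hC₀⟩ : ∃ C₀, ∀ k ω, |H k ω| ≤ C₀ * (1 + ℓ k ω) := by
    let M := (2 * c₁ + 2 * c₁ * ‖ustar‖ + c₂) + (2 * d₁ + 2 * d₁ * ‖ustar‖ + d₂)
    have hM : 0 ≤ M := by positivity
    refine ⟨M * (1 + 2 / b), fun k ω => ?_⟩
    have hC := StochAPP.abs_sub_le_of_linear_growth hc₁ hc₂ hjC_ne hjC_bdd (hUmem k ω) hustar
      (Ws (k + 1) ω)
    have hA := StochAPP.abs_sub_le_of_linear_growth hd₁ hd₂ hjA_ne hjA_bdd (hUmem k ω) hustar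
      (Ws (k + 1) ω)
    have hsum : |H k ω| ≤ M * (1 + ‖U k ω - ustar‖ ^ 2) := by
      simp only [H, f, add_sub_add_comm]
      exact (abs_add_le _ _).trans ((add_le_add hC hA).trans_eq (add_mul _ _ _).symm)
    have hD : ‖U k ω - ustar‖ ^ 2 ≤ 2 / b * ℓ k ω := by
      rw [div_mul_eq_mul_div, le_div_iff₀ hb]
      linarith [hℓ_lower _ (hUmem k ω)]
    have h2b : 0 ≤ 2 / b := by positivity
    rw [mul_assoc]
    refine hsum.trans (mul_le_mul_of_nonneg_left ?_ hM)
    nlinarith [hℓ_nonneg k ω]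
  -- the errors
  let Q : ℕ → ℝ := fun k => (essSup (fun ω => ‖R k ω‖ₑ) μ).toReal
  have hQ_nonneg : ∀ k, 0 ≤ Q k := fun k => ENNReal.toReal_nonneg
  have hQε_nonneg : ∀ k, 0 ≤ Q k * ε k := fun k => mul_nonneg (hQ_nonneg k) (hε_pos k).le
  -- Since ε k > 0, an infinite essential supremum would make the series infinite; so `toReal` loses
  -- nothing.
  have hQ_fin : ∀ k, essSup (fun ω => ‖R k ω‖ₑ) μ ≠ ∞ := fun k htop => by
    refine ENNReal.ne_top_of_tsum_ne_top hR_sum.ne k ?_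
    rw [htop]
    exact ENNReal.top_mul (by simpa using hε_pos k)
  have hQ_bound : ∀ k, ∀ᵐ ω ∂μ, ‖R k ω‖ ≤ Q k := fun k => by
    filter_upwards [ENNReal.ae_le_essSup fun ω => ‖R k ω‖ₑ] with ω hω
    have := ENNReal.toReal_mono (hQ_fin k) hω
    rwa [toReal_enorm] at this
  have hQ_sum : Summable fun k => Q k * ε k := by
    refine (ENNReal.summable_toReal hR_sum.ne).congr fun k => ?_
    rw [ENNReal.toReal_mul, ENNReal.toReal_ofReal (hε_pos k).le]
  have hε_sum := StochAPP.summable_sq_steps hθ hε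
  -- the recursion
  let α := c₁ + d₁
  let β := (c₁ + d₁) * ‖ustar‖ + (c₂ + d₂)
  -- The coefficients of `bregman_step_le_of_linear_growth` with ρ = Q k.
  let A : ℕ → ℝ := fun k => 2 / b * (3 * α ^ 2 / (2 * b) * ε k ^ 2 + Q k * ε k)
  let B : ℕ → ℝ := fun k =>
    3 * β ^ 2 / (2 * b) * ε k ^ 2 + 3 / (2 * b) * (Q k * ε k) ^ 2 + Q k * ε k
  have hA_nonneg : ∀ k, 0 ≤ A k := fun k =>
    mul_nonneg (by positivity) (add_nonneg (by positivity) (hQε_nonneg k))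
  have hB_nonneg : ∀ k, 0 ≤ B k := fun k =>
    add_nonneg (by positivity) (hQε_nonneg k)
  have hA_sum : Summable A := ((hε_sum.mul_left _).add hQ_sum).mul_left _
  have hB_sum : Summable B := ((hε_sum.mul_left _).add
    ((StochAPP.summable_sq_of_summable hQε_nonneg hQ_sum).mul_left _)).add hQ_sum
  have hstep : ∀ k, ∀ᵐ ω ∂μ, ℓ (k + 1) ω ≤ (1 + A k) * ℓ k ω + B k - ε k * H k ω := by
    intro k
    filter_upwards [hQ_bound k] with ω hω
    obtain ⟨s, hs⟩ := hjA_ne _ (hUmem k ω) (Ws (k + 1) ω)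
    have hg := hAPP.subgrad k ω
    refine StochAPP.bregman_step_le_of_linear_growth hb (hε_pos k).le
      (hK_strong _ (hUmem k ω) _ (hUmem (k + 1) ω)) (hℓ_lower _ (hUmem k ω)) hg hs ?_ hω
      (hAPP.variational_inequality hUad_conv hjA_conv hε_pos hK_diff' k ω hustar)
    have h1 := hjC_bdd _ (hUmem k ω) _ _ hg
    have h2 := hjA_bdd _ (hUmem k ω) _ _ hs
    have h3 : ‖U k ω‖ ≤ ‖U k ω - ustar‖ + ‖ustar‖ := by
      simpa using norm_add_le (U k ω - ustar) ustar
    have h4 := mul_le_mul_of_nonneg_left h3 (add_nonneg hc₁.le hd₁.le)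
    simp only [α, β]
    linarith
  have hrec := StochAPP.integrable_and_integral_of_almost_supermartingale hℓ_meas hH_meas
    hℓ_nonneg hℓ_int hC₀ hstep
  -- the expected gaps
  have hgap : ∀ k, Integrable (fun ω => J (U k ω) - J ustar) μ ∧
      ∫ ω, H k ω ∂μ = ∫ ω, (J (U k ω) - J ustar) ∂μ := fun k => by
    have h := StochAPP.integrable_and_integral_of_indepFun (hUm k) (hWm k)
      (hWs_law (k + 1) (by omega))
      (StochAPP.indepFun_of_measurable_sampleSigma hWs hWs_indep (hUσ k)) hf_meas (hrec k).1
    simpa only [hf_int _ (hUmem k _)] using h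
  have hgap_nonneg : ∀ k, 0 ≤ ε k * ∫ ω, (J (U k ω) - J ustar) ∂μ := fun k =>
    mul_nonneg (hε_pos k).le
      (integral_nonneg fun ω => sub_nonneg.2 (hJ_min _ (hUmem k ω)))
  obtain ⟨C, hC⟩ := StochAPP.exists_sum_le_of_almost_supermartingale
    (fun k => integral_nonneg (hℓ_nonneg k)) hgap_nonneg hA_nonneg hB_nonneg hA_sum hB_sum
    fun k => by rw [← (hgap k).2]; exact (hrec k).2
  have hC_nonneg : 0 ≤ C := by simpa using hC 0
  have havg := fun (n : ℕ) (hn : 1 ≤ n) =>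
    StochAPP.integrable_and_integral_averagedIterate_le (μ := μ) hJ_conv hJ_min hε_pos hUmem
      (fun k => (hgap k).1) hn (hJ_meas.comp (Finset.measurable_fun_sum _ fun k _ =>
        (hUm k).const_smul (ε k / ∑ l ∈ Finset.Icc 1 n, ε l))).aestronglyMeasurable
  have hrate : (fun n : ℕ => ∫ ω, (J (StochAPP.averagedIterate ε U 1 n ω) - J ustar) ∂μ)
      =O[atTop] (fun n : ℕ => (n : ℝ) ^ (θ - 1)) := by
    refine IsBigO.of_bound (C / c) ?_
    filter_upwards [eventually_ge_atTop 1] with n hn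
    have hn0 : (0 : ℝ) < n := by exact_mod_cast hn
    obtain ⟨-, h0, hle⟩ := havg n hn
    rw [Real.norm_of_nonneg h0, Real.norm_of_nonneg (by positivity)]
    -- The bound `hC (n + 1)` also counts the nonnegative term k = 0, which the average omits.
    have hsum : ∑ k ∈ Finset.Icc 1 n, ε k * ∫ ω, (J (U k ω) - J ustar) ∂μ ≤ C :=
      (Finset.sum_le_sum_of_subset_of_nonneg (fun k hk => Finset.mem_range.2
        (Nat.lt_succ_of_le (Finset.mem_Icc.1 hk).2)) fun k _ _ => hgap_nonneg k).trans (hC (n + 1))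
    have hden := StochAPP.rpow_le_sum_steps hc (by linarith) hε hn
    have hden_pos : 0 < c * (n : ℝ) ^ (1 - θ) := by positivity
    refine hle.trans ((div_le_div₀ hC_nonneg hsum hden_pos hden).trans_eq ?_)
    rw [← neg_sub 1 θ, Real.rpow_neg hn0.le, div_mul_eq_div_div, div_eq_mul_inv (C / c)]
  refine ⟨fun n hn => (havg n hn).1, hrate, fun δ _ hδ => hrate.trans (IsBigO.of_bound 1 ?_)⟩
  filter_upwards [eventually_ge_atTop 1] with n hn
  rw [one_mul, Real.norm_of_nonneg (by positivity), Real.norm_of_nonneg (by positivity)]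
  exact Real.rpow_le_rpow_of_exponent_le (by exact_mod_cast hn) (by linarith)
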